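/- Let $d\in\mathbb{N}$ and let $\mathcal{M}_d$ be the space of complex $d\times d$ matrices with the Hilbert–Schmidt inner product $\langle A,B\rangle=\mathrm{Tr}[A^\dagger B]$; singular values and determinants of linear maps $\mathcal{M}_d\to\mathcal{M}_d$ refer to this $d^2$-dimensional space, and $s_1^{\uparrow}(S)$ denotes the smallest of the $d^2$ singular values of $S$. A quantum channel on $\mathcal{M}_d$ is a completely positive trace-preserving linear map $\mathcal{M}_d\to\mathcal{M}_d$. A Lindblad generator is a linear map $L$ on $\mathcal{M}_d$ of the form $$L(\rho)=i[\rho,H]+\sum_{j}\Big(\mathcal{L}_j\rho\mathcal{L}_j^\dagger-\tfrac12\{\mathcal{L}_j^\dagger\mathcal{L}_j,\rho\}\Big)$$ with $H=H^\dagger\in\mathcal{M}_d$ and finitely many $\mathcal{L}_j\in\mathcal{M}_d$. Let $\mathcal{I}_d$ be the set of linear maps $S$ on $\mathcal{M}_d$ such that for every $\delta>0$ there are $n\in\mathbb{N}$ and Lindblad generators $L_1,\dots,L_n$ with $\|e^{L_j}-\mathrm{id}\|\le\delta$ for all $j$ and $\prod_{j=1}^n e^{L_j}=S$. A map is called infinitesimal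 divisible if it lies in the closure $\overline{\mathcal{I}}_d$. Let $T:\mathcal{M}_d\to\mathcal{M}_d$ be a quantum channel that has singular value $0$ with multiplicity exactly $k$, where $1\le k<\frac d2$. Then every neighbourhood of $T$ contains a quantum channel that is not infinitesimal divisible. Explicitly, put $T_\varepsilon=(1-\varepsilon)T+\varepsilon\,\mathrm{id}$. Then there is $\varepsilon_0>0$ such that for all $0<\varepsilon<\varepsilon_0$ the map $T_\varepsilon$ is a quantum channel, $\det(T_\varepsilon)$ is real, $T_\varepsilon$ violates the power criterion $0\le\det(T_\varepsilon)\le\big(s_1^{\uparrow}(T_\varepsilon)\big)^{d/2}$, that is, $\det(T_\varepsilon)<0$ or $\det(T_\varepsilon)>\big(s_1^{\uparrow}(T_\varepsilon)\big)^{d/2}$, and $T_\varepsilon$ is not infinitesimal divisible. -/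

import Mathlib

open scoped Topology ComplexOrder Matrix

/-- The space of complex `d × d` matrices. -/
abbrev Mat (d : ℕ) : Type := Matrix (Fin d) (Fin d) ℂ

-- The matrix space carries the Frobenius (Hilbert-Schmidt) norm throughout.
attribute [local instance] Matrix.frobeniusNormedAddCommGroup Matrix.frobeniusNormedSpace

/-- The topology of `M_d` is the one given by this norm (as a topology it is just the entrywise
one; the instance fixes the form in which it is found). -/
noncomputable instance matTopology (d : ℕ) : TopologicalSpace (Mat d) :=
  Matrix.frobeniusNormedAddCommGroup.toPseudoMetricSpace.toUniformSpace.toTopologicalSpace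

/-- The Hilbert-Schmidt inner product `⟪A, B⟫ = Tr (A† B)`; its norm is the Frobenius norm. -/
noncomputable instance hilbertSchmidt (d : ℕ) : InnerProductSpace ℂ (Mat d) where
  toNormedSpace := Matrix.frobeniusNormedSpace
  inner A B := (Aᴴ * B).trace
  norm_sq_eq_re_inner A := by
    rw [Matrix.frobenius_norm_def, ← Real.sqrt_eq_rpow, Real.sq_sqrt (by positivity)]
    simp only [Real.rpow_two, Matrix.trace, Matrix.diag_apply, Matrix.mul_apply,
      Matrix.conjTranspose_apply, map_sum]
    rw [Finset.sum_comm]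
    refine Finset.sum_congr rfl fun j _ => Finset.sum_congr rfl fun i _ => ?_
    rw [← Complex.normSq_eq_norm_sq, Complex.normSq_apply]
    simp
  conj_inner_symm A B := by
    rw [starRingEnd_apply, ← Matrix.trace_conjTranspose, Matrix.conjTranspose_mul,
      Matrix.conjTranspose_conjTranspose]
  add_left A B C := by
    rw [Matrix.conjTranspose_add, Matrix.add_mul, Matrix.trace_add]
  smul_left A B r := by
    rw [Matrix.conjTranspose_smul, Matrix.smul_mul, Matrix.trace_smul]
    rfl

/-- Linear maps `M_d → M_d`. Every linear map on the finite-dimensional space `M_d` is continuous;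
the continuous bundling supplies the operator norm and hence the topology on these maps. -/
abbrev SuperOp (d : ℕ) : Type := Mat d →L[ℂ] Mat d

/-- `T ⊗ id` on `M_d ⊗ M_n`, the latter identified with matrices indexed by pairs: `T` is applied
to each of the `n × n` blocks of size `d × d`. -/
noncomputable def ampliation {d : ℕ} (T : SuperOp d) (n : ℕ) (X : Matrix (Fin d × Fin n) (Fin d × Fin n) ℂ) :
    Matrix (Fin d × Fin n) (Fin d × Fin n) ℂ :=
  Matrix.of fun p q => T (Matrix.of fun a b => X (a, p.2) (b, q.2)) p.1 q.1

/-- `T ⊗ id_n` preserves positive semidefiniteness for every `n`. -/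
def IsCompletelyPositive {d : ℕ} (T : SuperOp d) : Prop :=
  ∀ (n : ℕ) (X : Matrix (Fin d × Fin n) (Fin d × Fin n) ℂ),
    X.PosSemidef → (ampliation T n X).PosSemidef

/-- Quantum channels on `M_d`: completely positive trace-preserving linear maps. -/
def IsQuantumChannel {d : ℕ} (T : SuperOp d) : Prop :=
  IsCompletelyPositive T ∧ ∀ ρ : Mat d, (T ρ).trace = ρ.trace

/-- Lindblad generators:
`L(ρ) = i[ρ, H] + ∑ j, (V j ρ (V j)† - ½ {(V j)† V j, ρ})` with `H` self-adjoint. -/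
def IsLindbladGenerator {d : ℕ} (L : SuperOp d) : Prop :=
  ∃ H : Mat d, H.IsHermitian ∧ ∃ (m : ℕ) (V : Fin m → Mat d), ∀ ρ : Mat d,
    L ρ = Complex.I • (ρ * H - H * ρ) +
      ∑ j, (V j * ρ * (V j)ᴴ - (1 / 2 : ℂ) • ((V j)ᴴ * V j * ρ + ρ * ((V j)ᴴ * V j)))

/-- The maps that, for every `ε > 0`, are a finite (ordered) product of exponentials of generators
from `𝒢`, each factor being `ε`-close to the identity. Multiplication of maps is composition. -/
def infinitesimalProducts {d : ℕ} (𝒢 : Set (SuperOp d)) : Set (SuperOp d) :=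
  {T | ∀ ε : ℝ, 0 < ε → ∃ (n : ℕ) (G : Fin n → SuperOp d),
    (∀ j, G j ∈ 𝒢) ∧ (∀ j, ‖NormedSpace.exp (G j) - 1‖ ≤ ε) ∧
      (List.ofFn fun j => NormedSpace.exp (G j)).prod = T}

/-- Infinitesimal (Markovian) divisible maps: the closure of the set of infinitesimal products
with respect to the set of Lindblad generators. -/
def IsInfinitesimalDivisible {d : ℕ} (T : SuperOp d) : Prop :=
  T ∈ closure (infinitesimalProducts {L : SuperOp d | IsLindbladGenerator L})

/-- The singular values `s_0 ≥ s_1 ≥ … ≥ s_{d²-1}` of `T`, with respect to the Hilbert-Schmidt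
inner product. -/
noncomputable def superSingularValue {d : ℕ} (T : SuperOp d) (i : Fin (d ^ 2)) : ℝ :=
  (T : Mat d →ₗ[ℂ] Mat d).singularValues i

/-- The multiplicity of `s` among the `d²` singular values of `T`. -/
noncomputable def singularMultiplicity {d : ℕ} (T : SuperOp d) (s : ℝ) : ℕ :=
  Nat.card {i : Fin (d ^ 2) // superSingularValue T i = s}

/-- The smallest of the `d²` singular values of `T` (for `d ≥ 1`). -/
noncomputable def minSingularValue {d : ℕ} (T : SuperOp d) : ℝ :=
  (T : Mat d →ₗ[ℂ] Mat d).singularValues (d ^ 2 - 1)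

/-- The convex combination `(1 - ε) T + ε id`. -/
noncomputable def mixWithId {d : ℕ} (T : SuperOp d) (ε : ℝ) : SuperOp d :=
  ((1 - ε : ℝ) : ℂ) • T + (ε : ℂ) • ContinuousLinearMap.id ℂ (Mat d)

/-!
The power criterion is a necessary condition for divisibility which `T_ε` violates for small `ε`.

**Power criterion.** For a Lindblad generator `L` with operators `V j`,
`Tr L = ∑ j, (|Tr (V j)|² - d ‖V j‖²)`. Shifting each `V j` to a traceless `W j` changes `L` only by
a commutator with a skew-Hermitian matrix and gives `Tr L = -d ∑ j, ‖W j‖²`, while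
submultiplicativity of the Frobenius norm gives `Re ⟪X, L X⟫ ≥ -2 ∑ j, ‖W j‖² ‖X‖²`. Hence
`Re ⟪X, L X⟫ ≥ (2 / d) Tr L ‖X‖²`. Integrating along `t ↦ exp (t L) X` and using
`det (exp L) = exp (Tr L)` yields `‖exp L X‖ ≥ det (exp L) ^ (2 / d) ‖X‖`. Together with
`0 ≤ det` this condition (`SatisfiesPowerBound`) is stable under products and limits, so it holds
for every infinitesimal divisible map
(`IsInfinitesimalDivisible.satisfiesPowerBound`); the best constant in `‖S X‖ ≥ s ‖X‖` is the
smallest singular value.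

**Violation.** Let `T` have rank `d² - k`. On a complement of its kernel `T` is bounded below,
and so are all nearby maps, with a constant `c > 0`. By the Courant-Fischer principle at least
`d² - k` singular values of `T_ε` are at least `c`, and since `|det T_ε|` is the product of all of
them, `|det T_ε| ≥ c ^ (d² - k) * s ^ k`, where `s` is the smallest one. Here `0 < s ≤ ε`: a unit
vector in the kernel of `T` is mapped by `T_ε` to a vector of norm `ε`, and `T_ε` is invertible for
small `ε > 0` because `T` has finitely many eigenvalues. As `k < d / 2`, the lower bound beats
`s ^ (d / 2)` (`eventually_singularValues_rpow_lt_norm_det`). Finally `det T_ε` is real because the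
Choi matrix of a completely positive map is Hermitian (`IsCompletelyPositive.det_im`).
-/

open Module Filter NormedSpace

/-! ### The determinant of an exponential -/

theorem differentiable_det {E : Type*} [NormedAddCommGroup E] [NormedSpace ℂ E]
    [FiniteDimensional ℂ E] : Differentiable ℂ fun A : E →L[ℂ] E => A.det := by
  let b := finBasis ℂ E
  have h : (fun A : E →L[ℂ] E => A.det) = fun A : E →L[ℂ] E =>
      ∑ σ : Equiv.Perm (Fin (finrank ℂ E)), Equiv.Perm.sign σ •
        ∏ i, (b.coord (σ i)).toContinuousLinearMap (A (b i)) := by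
    ext A
    rw [ContinuousLinearMap.det, ← LinearMap.det_toMatrix b, Matrix.det_apply]
    simp [LinearMap.toMatrix_apply]
  rw [h]
  refine Differentiable.fun_sum fun σ _ => Differentiable.const_smul ?_ _
  fun_prop

theorem hasDerivAt_det_one_add_smul {E : Type*} [NormedAddCommGroup E] [NormedSpace ℂ E]
    [FiniteDimensional ℂ E] (A : E →L[ℂ] E) :
    HasDerivAt (fun t : ℂ => (1 + t • A).det) (LinearMap.trace ℂ E A) 0 := by
  let b := finBasis ℂ E
  set M := LinearMap.toMatrix b b (A : E →ₗ[ℂ] E) with hM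
  have h : (fun t : ℂ => (1 + t • A).det) = fun t : ℂ => 1 + M.trace * t +
      ((Matrix.det (1 + (Polynomial.X : Polynomial ℂ) • M.map Polynomial.C)).divX.divX).eval t
        * t ^ 2 := by
    ext t
    rw [← Matrix.det_one_add_smul, ContinuousLinearMap.det, ← LinearMap.det_toMatrix b]
    congr 1
    rw [ContinuousLinearMap.toLinearMap_add, ContinuousLinearMap.toLinearMap_smul, map_add,
      map_smul]
    congr 1
    exact LinearMap.toMatrix_one b
  rw [h, LinearMap.trace_eq_matrix_trace ℂ b, ← hM]
  have h1 := (((hasDerivAt_id (0 : ℂ)).const_mul M.trace).const_add 1).add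
    ((((Matrix.det (1 + (Polynomial.X : Polynomial ℂ) • M.map Polynomial.C)).divX.divX).hasDerivAt
      0).mul ((hasDerivAt_id (0 : ℂ)).pow 2))
  convert! h1 using 1
  simp

theorem ContinuousLinearMap.det_mul {E : Type*} [NormedAddCommGroup E] [NormedSpace ℂ E]
    (A B : E →L[ℂ] E) : (A * B).det = A.det * B.det :=
  LinearMap.det_comp _ _

theorem ContinuousLinearMap.det_id' {E : Type*} [NormedAddCommGroup E] [NormedSpace ℂ E] :
    (1 : E →L[ℂ] E).det = 1 :=
  LinearMap.det_id

/-- The function `t ↦ det (exp (t A))` is multiplicative with derivative `Tr A` at `0`, so it solves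
the differential equation of `t ↦ exp (t Tr A)`. -/
theorem det_exp_eq_exp_trace {E : Type*} [NormedAddCommGroup E] [NormedSpace ℂ E]
    [FiniteDimensional ℂ E] (A : E →L[ℂ] E) :
    (exp A).det = Complex.exp (LinearMap.trace ℂ E A) := by
  have : CompleteSpace E := FiniteDimensional.complete ℂ E
  let : NormedAlgebra ℚ (E →L[ℂ] E) := NormedAlgebra.restrictScalars ℚ ℂ _
  set τ := LinearMap.trace ℂ E A with hτ
  have hD := (differentiable_det (E := E) 1).hasFDerivAt
  -- The derivative of `det` at `1` is read off along the line `1 + t A`.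
  have hτ' : fderiv ℂ (fun A : E →L[ℂ] E => A.det) 1 A = τ := by
    have hl : HasDerivAt (fun t : ℂ => (1 : E →L[ℂ] E) + t • A) A 0 := by
      simpa using ((hasDerivAt_id (0 : ℂ)).smul_const A).const_add 1
    have h0 : (1 : E →L[ℂ] E) = 1 + (0 : ℂ) • A := by simp
    rw [h0] at hD
    have := hD.comp_hasDerivAt (0 : ℂ) hl
    rw [← h0] at this
    exact this.unique (hasDerivAt_det_one_add_smul A)
  have h0 : HasDerivAt (fun t : ℂ => (exp (t • A)).det) τ 0 := by
    have he := hasDerivAt_exp_smul_const (𝕂 := ℂ) A 0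
    simp only [zero_smul, exp_zero, one_mul] at he
    have h1 : (1 : E →L[ℂ] E) = exp ((0 : ℂ) • A) := by simp
    rw [h1] at hD
    have := hD.comp_hasDerivAt (0 : ℂ) he
    rw [← h1, hτ'] at this
    exact this
  have hf : ∀ t : ℂ, HasDerivAt (fun t : ℂ => (exp (t • A)).det) ((exp (t • A)).det * τ) t := by
    intro t
    have hs : (fun u : ℂ => (exp (u • A)).det) =
        fun u : ℂ => (exp (t • A)).det * (exp ((u - t) • A)).det := by
      ext u
      rw [← ContinuousLinearMap.det_mul, ← exp_add_of_commute, ← add_smul, add_sub_cancel]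
      exact ((Commute.refl A).smul_left _).smul_right _
    rw [hs]
    refine HasDerivAt.const_mul _ ?_
    have h0' : HasDerivAt (fun t : ℂ => (exp (t • A)).det) τ (t - t) := by simpa using h0
    exact h0'.comp_sub_const t t
  have hg : ∀ t : ℂ, HasDerivAt (fun t : ℂ => (exp (t • A)).det * Complex.exp (-(t * τ))) 0 t := by
    intro t
    have he : HasDerivAt (fun t : ℂ => Complex.exp (-(t * τ)))
        (Complex.exp (-(t * τ)) * -τ) t := by
      simpa using (((hasDerivAt_id t).mul_const τ).neg).cexp
    convert! (hf t).mul he using 1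
    ring
  have hc := is_const_of_deriv_eq_zero (fun t => (hg t).differentiableAt)
    (fun t => (hg t).deriv) 1 0
  simp only [one_smul, zero_smul, exp_zero, one_mul, zero_mul, neg_zero, Complex.exp_zero,
    ContinuousLinearMap.det_id', mul_one, Complex.exp_neg] at hc
  rwa [mul_inv_eq_one₀ (Complex.exp_ne_zero _)] at hc

/-! ### Lower bounds for exponentials -/

/-- A lower bound `c` on the numerical range of the Hermitian part of `A` bounds `exp A` from below:
the function `t ↦ exp (-2 c t) * ‖exp (t A) x‖²` is monotone. -/
theorem exp_mul_norm_le_norm_exp_apply {E : Type*} [NormedAddCommGroup E] [InnerProductSpace ℂ E]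
    [FiniteDimensional ℂ E] (A : E →L[ℂ] E) (c : ℝ)
    (h : ∀ x, c * ‖x‖ ^ 2 ≤ (inner ℂ x (A x)).re) (x : E) :
    Real.exp c * ‖x‖ ≤ ‖exp A x‖ := by
  have : CompleteSpace E := FiniteDimensional.complete ℂ E
  have hy : ∀ t : ℝ, HasDerivAt (fun t : ℝ => exp (t • A) x) (A (exp (t • A) x)) t := fun t =>
    ((ContinuousLinearMap.apply ℂ E x).restrictScalars ℝ).hasFDerivAt.comp_hasDerivAt t
      (hasDerivAt_exp_smul_const' (𝕂 := ℝ) A t)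
  have hn : ∀ t : ℝ, HasDerivAt (fun t : ℝ => ‖exp (t • A) x‖ ^ 2)
      (2 * (inner ℂ (exp (t • A) x) (A (exp (t • A) x))).re) t := by
    intro t
    have h1 := Complex.reCLM.hasFDerivAt.comp_hasDerivAt t ((hy t).inner ℂ (hy t))
    convert! h1 using 1
    · ext s
      exact norm_sq_eq_re_inner (𝕜 := ℂ) _
    · simp only [map_add, Complex.reCLM_apply]
      rw [← inner_conj_symm (A _), Complex.conj_re]
      ring
  have hm : Monotone fun t : ℝ => Real.exp (-(2 * c * t)) * ‖exp (t • A) x‖ ^ 2 := by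
    have hd : ∀ t : ℝ, HasDerivAt (fun t : ℝ => Real.exp (-(2 * c * t)) * ‖exp (t • A) x‖ ^ 2)
        (Real.exp (-(2 * c * t)) * (-(2 * c)) * ‖exp (t • A) x‖ ^ 2 + Real.exp (-(2 * c * t)) *
          (2 * (inner ℂ (exp (t • A) x) (A (exp (t • A) x))).re)) t := by
      intro t
      have he : HasDerivAt (fun t : ℝ => Real.exp (-(2 * c * t)))
          (Real.exp (-(2 * c * t)) * (-(2 * c))) t := by
        simpa using (((hasDerivAt_id t).const_mul (2 * c)).neg).exp
      exact he.mul (hn t)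
    refine monotone_of_deriv_nonneg (fun t => (hd t).differentiableAt) fun t => ?_
    rw [(hd t).deriv]
    have := mul_nonneg (Real.exp_pos (-(2 * c * t))).le (sub_nonneg.2 (h (exp (t • A) x)))
    linarith
  have h01 := hm zero_le_one
  simp only [mul_zero, neg_zero, Real.exp_zero, zero_smul, exp_zero, one_mul, one_smul, mul_one,
    one_apply_eq_self] at h01
  refine le_of_sq_le_sq ?_ (norm_nonneg _)
  calc (Real.exp c * ‖x‖) ^ 2 = Real.exp (2 * c) * ‖x‖ ^ 2 := by
        rw [mul_pow, ← Real.exp_nat_mul]; norm_num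
    _ ≤ Real.exp (2 * c) * (Real.exp (-(2 * c)) * ‖exp A x‖ ^ 2) := by gcongr
    _ = ‖exp A x‖ ^ 2 := by rw [← mul_assoc, ← Real.exp_add]; simp

/-! ### The power criterion -/

/-- The power criterion `0 ≤ det A ≤ s ^ (1 / p)` for the smallest singular value `s` of `A`, with
the bound on `s` written as a lower bound for `‖A x‖`. In this form it makes sense in any normed
space and is visibly stable under products and limits. -/
def SatisfiesPowerBound {E : Type*} [NormedAddCommGroup E] [NormedSpace ℂ E] (p : ℝ)
    (A : E →L[ℂ] E) : Prop :=
  A.det.im = 0 ∧ 0 ≤ A.det.re ∧ ∀ x, A.det.re ^ p * ‖x‖ ≤ ‖A x‖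

theorem SatisfiesPowerBound.one {E : Type*} [NormedAddCommGroup E] [NormedSpace ℂ E] (p : ℝ) :
    SatisfiesPowerBound p (1 : E →L[ℂ] E) := by
  simp [SatisfiesPowerBound, ContinuousLinearMap.det_id']

theorem SatisfiesPowerBound.mul {E : Type*} [NormedAddCommGroup E] [NormedSpace ℂ E] {p : ℝ}
    {A B : E →L[ℂ] E} (hA : SatisfiesPowerBound p A) (hB : SatisfiesPowerBound p B) :
    SatisfiesPowerBound p (A * B) := by
  obtain ⟨hA0, hA1, hA2⟩ := hA
  obtain ⟨hB0, hB1, hB2⟩ := hB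
  have hre : (A * B).det.re = A.det.re * B.det.re := by
    rw [ContinuousLinearMap.det_mul, Complex.mul_re, hA0]; ring
  refine ⟨by rw [ContinuousLinearMap.det_mul, Complex.mul_im, hA0, hB0]; ring,
    by rw [hre]; positivity, fun x => ?_⟩
  rw [hre, Real.mul_rpow hA1 hB1, mul_assoc]
  calc A.det.re ^ p * (B.det.re ^ p * ‖x‖) ≤ A.det.re ^ p * ‖B x‖ := by
        gcongr
        exact hB2 x
    _ ≤ ‖A (B x)‖ := hA2 _

theorem SatisfiesPowerBound.list_prod {E : Type*} [NormedAddCommGroup E] [NormedSpace ℂ E] {p : ℝ}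
    {l : List (E →L[ℂ] E)} (h : ∀ A ∈ l, SatisfiesPowerBound p A) :
    SatisfiesPowerBound p l.prod := by
  induction l with
  | nil => exact .one p
  | cons A l ih =>
    rw [List.prod_cons]
    exact (h A (by simp)).mul (ih fun B hB => h B (by simp [hB]))

theorem isClosed_satisfiesPowerBound {E : Type*} [NormedAddCommGroup E] [NormedSpace ℂ E]
    {p : ℝ} (hp : 0 ≤ p) : IsClosed {A : E →L[ℂ] E | SatisfiesPowerBound p A} := by
  have hd : Continuous fun A : E →L[ℂ] E => A.det := ContinuousLinearMap.continuous_det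
  have hre : Continuous fun A : E →L[ℂ] E => A.det.re := Complex.continuous_re.comp hd
  have h : {A : E →L[ℂ] E | SatisfiesPowerBound p A} = {A | A.det.im = 0} ∩
      ({A | 0 ≤ A.det.re} ∩ ⋂ x, {A | A.det.re ^ p * ‖x‖ ≤ ‖A x‖}) := by
    ext A
    simp [SatisfiesPowerBound]
  rw [h]
  refine (isClosed_eq (Complex.continuous_im.comp hd) continuous_const).inter
    ((isClosed_le continuous_const hre).inter (isClosed_iInter fun x => isClosed_le
      ((hre.rpow_const fun _ => Or.inr hp).mul continuous_const) ?_))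
  fun_prop

theorem satisfiesPowerBound_exp {E : Type*} [NormedAddCommGroup E] [InnerProductSpace ℂ E]
    [FiniteDimensional ℂ E] {p τ : ℝ} (A : E →L[ℂ] E) (hτ : LinearMap.trace ℂ E A = (τ : ℂ))
    (h : ∀ x, p * τ * ‖x‖ ^ 2 ≤ (inner ℂ x (A x)).re) : SatisfiesPowerBound p (exp A) := by
  have hdet : (exp A).det = ((Real.exp τ : ℝ) : ℂ) := by
    rw [det_exp_eq_exp_trace, hτ, Complex.ofReal_exp]
  refine ⟨by rw [hdet, Complex.ofReal_im], by rw [hdet, Complex.ofReal_re]; positivity,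
    fun x => ?_⟩
  rw [hdet, Complex.ofReal_re, ← Real.exp_mul, mul_comm τ]
  exact exp_mul_norm_le_norm_exp_apply A _ h x

/-! ### Singular values -/

theorem norm_apply_sq_eq_sum_singularValues {E : Type*} [NormedAddCommGroup E]
    [InnerProductSpace ℂ E] [FiniteDimensional ℂ E] (A : E →ₗ[ℂ] E) (x : E) :
    ‖A x‖ ^ 2 = ∑ i : Fin (finrank ℂ E), A.singularValues i ^ 2 *
      ‖inner ℂ (A.isSymmetric_adjoint_comp_self.eigenvectorBasis rfl i) x‖ ^ 2 := by
  set b := A.isSymmetric_adjoint_comp_self.eigenvectorBasis rfl with hb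
  have h1 : (‖A x‖ ^ 2 : ℝ) = (inner ℂ x ((A.adjoint ∘ₗ A) x)).re := by
    rw [LinearMap.comp_apply, LinearMap.adjoint_inner_right]
    exact norm_sq_eq_re_inner (𝕜 := ℂ) _
  rw [h1, ← b.sum_inner_mul_inner, Complex.re_sum]
  refine Finset.sum_congr rfl fun i _ => ?_
  have h2 : inner ℂ (b i) ((A.adjoint ∘ₗ A) x) =
      ((A.singularValues i ^ 2 : ℝ) : ℂ) * inner ℂ (b i) x := by
    rw [← A.isSymmetric_adjoint_comp_self, hb, LinearMap.IsSymmetric.apply_eigenvectorBasis,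
      ← A.sq_singularValues_fin rfl i, inner_smul_left]
    simp
  rw [h2, ← inner_conj_symm x, mul_left_comm, ← Complex.normSq_eq_conj_mul_self,
    ← Complex.ofReal_mul, Complex.ofReal_re, Complex.normSq_eq_norm_sq]

theorem singularValues_last_mul_norm_le {E : Type*} [NormedAddCommGroup E]
    [InnerProductSpace ℂ E] [FiniteDimensional ℂ E] (A : E →ₗ[ℂ] E) (x : E) :
    A.singularValues (finrank ℂ E - 1) * ‖x‖ ≤ ‖A x‖ := by
  refine le_of_sq_le_sq ?_ (norm_nonneg _)
  rw [mul_pow, norm_apply_sq_eq_sum_singularValues,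
    ← (A.isSymmetric_adjoint_comp_self.eigenvectorBasis rfl).sum_sq_norm_inner_right x,
    Finset.mul_sum]
  refine Finset.sum_le_sum fun i _ => ?_
  gcongr
  · exact A.singularValues_nonneg _
  · exact A.singularValues_antitone (by have := i.isLt; omega)

/-- The easy half of the Courant-Fischer principle: a map bounded below by `c` on an
`r`-dimensional subspace has at least `r` singular values that are at least `c`. -/
theorem le_singularValues_of_forall_mem {E : Type*} [NormedAddCommGroup E]
    [InnerProductSpace ℂ E] [FiniteDimensional ℂ E] (A : E →ₗ[ℂ] E) (W : Submodule ℂ E) {c : ℝ}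
    (h : ∀ x ∈ W, c * ‖x‖ ≤ ‖A x‖) {i : ℕ} (hi : i < finrank ℂ W) :
    c ≤ A.singularValues i := by
  set b := A.isSymmetric_adjoint_comp_self.eigenvectorBasis rfl with hb
  have hn : i < finrank ℂ E := hi.trans_le W.finrank_le
  let φ : W →ₗ[ℂ] (Fin i → ℂ) :=
    LinearMap.pi fun j => (innerₛₗ ℂ (b ⟨j, j.isLt.trans hn⟩)) ∘ₗ W.subtype
  have hφ : LinearMap.ker φ ≠ ⊥ := LinearMap.ker_ne_bot_of_finrank_lt (by simpa using hi)
  obtain ⟨x, hx, hx0⟩ := Submodule.exists_mem_ne_zero_of_ne_bot hφ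
  have hz : ∀ j : Fin (finrank ℂ E), (j : ℕ) < i → inner ℂ (b j) (x : E) = 0 := fun j hj =>
    congrFun (LinearMap.mem_ker.1 hx) ⟨j, hj⟩
  have hle : ‖A x‖ ^ 2 ≤ (A.singularValues i * ‖(x : E)‖) ^ 2 := by
    rw [mul_pow, norm_apply_sq_eq_sum_singularValues, ← b.sum_sq_norm_inner_right (x : E),
      Finset.mul_sum]
    refine Finset.sum_le_sum fun j _ => ?_
    rcases lt_or_ge (j : ℕ) i with hj | hj
    · rw [← hb, hz j hj]; simp
    · gcongr
      · exact A.singularValues_nonneg _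
      · exact A.singularValues_antitone hj
  have h2 := (h x x.2).trans
    (le_of_sq_le_sq hle (mul_nonneg (A.singularValues_nonneg i) (norm_nonneg _)))
  exact le_of_mul_le_mul_right h2 (by simpa using hx0)

/-- `|det A|` is the product of the singular values: `dim W` of them are at least `c`, and the others
are at least the smallest one. -/
theorem pow_mul_pow_le_norm_det {E : Type*} [NormedAddCommGroup E]
    [InnerProductSpace ℂ E] [FiniteDimensional ℂ E] (A : E →L[ℂ] E) (W : Submodule ℂ E) {c : ℝ}
    (hc : 0 ≤ c) (h : ∀ x ∈ W, c * ‖x‖ ≤ ‖A x‖) :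
    c ^ finrank ℂ W * (A : E →ₗ[ℂ] E).singularValues (finrank ℂ E - 1) ^
      (finrank ℂ E - finrank ℂ W) ≤ ‖A.det‖ := by
  rw [ContinuousLinearMap.det, ← LinearMap.normDet_eq_norm_det,
    LinearMap.normDet_eq_prod_singularValues,
    ← Finset.prod_range_mul_prod_Ico _ W.finrank_le]
  set s := (A : E →ₗ[ℂ] E).singularValues
  have hs : ∀ i, 0 ≤ s i := LinearMap.singularValues_nonneg _
  have h1 : c ^ finrank ℂ W ≤ ∏ i ∈ Finset.range (finrank ℂ W), s i := by
    rw [← Finset.card_range (finrank ℂ W), ← Finset.prod_const, Finset.card_range]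
    exact Finset.prod_le_prod (fun _ _ => hc) fun i hi =>
      le_singularValues_of_forall_mem _ W h (Finset.mem_range.1 hi)
  have h2 : s (finrank ℂ E - 1) ^ (finrank ℂ E - finrank ℂ W) ≤
      ∏ i ∈ Finset.Ico (finrank ℂ W) (finrank ℂ E), s i := by
    rw [← Nat.card_Ico (finrank ℂ W), ← Finset.prod_const]
    refine Finset.prod_le_prod (fun _ _ => hs _) fun i hi =>
      LinearMap.singularValues_antitone _ ?_
    have := (Finset.mem_Ico.1 hi).2
    omega
  exact mul_le_mul h1 h2 (pow_nonneg (hs _) _) (Finset.prod_nonneg fun i _ => hs i)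

/-! ### Perturbing a singular map by the identity -/

/-- The map `(1 - ε) T + ε id` is singular only if `-ε / (1 - ε)` is one of the finitely many
eigenvalues of `T`. -/
theorem eventually_injective_convex_comb {E : Type*} [NormedAddCommGroup E] [NormedSpace ℂ E]
    [FiniteDimensional ℂ E] (T : E →L[ℂ] E) :
    ∀ᶠ ε : ℝ in 𝓝[>] 0,
      Function.Injective (((1 - ε : ℝ) : ℂ) • T + (ε : ℂ) • ContinuousLinearMap.id ℂ E) := by
  have hfin : ({μ : ℂ | End.HasEigenvalue (T : End ℂ E) μ} \ {0}).Finite :=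
    (End.finite_hasEigenvalue (T : End ℂ E)).subset Set.sdiff_subset
  have hnear : ∀ᶠ z : ℂ in 𝓝 0, z ∉ {μ : ℂ | End.HasEigenvalue (T : End ℂ E) μ} \ {0} :=
    hfin.isClosed.isOpen_compl.mem_nhds (by simp)
  have ht : Tendsto (fun ε : ℝ => ((-(ε / (1 - ε)) : ℝ) : ℂ)) (𝓝[>] 0) (𝓝 0) := by
    have hc : ContinuousAt (fun ε : ℝ => ((-(ε / (1 - ε)) : ℝ) : ℂ)) 0 :=
      Complex.continuous_ofReal.continuousAt.comp
        ((continuousAt_id.div (by fun_prop) (by simp)).neg)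
    have h2 := hc.tendsto
    simp only [zero_div, neg_zero, Complex.ofReal_zero] at h2
    exact h2.mono_left nhdsWithin_le_nhds
  filter_upwards [ht.eventually hnear, Ioo_mem_nhdsGT (zero_lt_one' ℝ)] with ε hε ⟨h0, h1⟩
  rw [injective_iff_map_eq_zero]
  intro x hx
  by_contra hx0
  have h1' : (1 - ε : ℝ) ≠ 0 := by linarith
  refine hε ⟨End.hasEigenvalue_of_hasEigenvector (x := x)
    ⟨End.mem_eigenspace_iff.2 ?_, hx0⟩, ?_⟩
  · have h2 : ((1 - ε : ℝ) : ℂ) • T x = -((ε : ℂ) • x) := by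
      rw [eq_neg_iff_add_eq_zero]
      exact hx
    have h3 : T x = (((1 - ε : ℝ) : ℂ)⁻¹) • (((1 - ε : ℝ) : ℂ) • T x) := by
      rw [inv_smul_smul₀ (by exact_mod_cast h1')]
    refine h3.trans ?_
    rw [h2, smul_neg, smul_smul, ← neg_smul]
    congr 1
    push_cast
    ring
  · have : -(ε / (1 - ε)) ≠ 0 := neg_ne_zero.2 (div_ne_zero h0.ne' h1')
    rw [Set.mem_singleton_iff]
    exact_mod_cast this

/-- The subspace is a complement of the kernel, on which `T` is injective. -/
theorem exists_pos_eventually_bound_below {E : Type*} [NormedAddCommGroup E] [NormedSpace ℂ E]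
    [FiniteDimensional ℂ E] (T : E →L[ℂ] E) :
    ∃ W : Submodule ℂ E, finrank ℂ W = finrank ℂ (LinearMap.range (T : E →ₗ[ℂ] E)) ∧
      ∃ c : ℝ, 0 < c ∧ ∀ᶠ A in 𝓝 T, ∀ x ∈ W, c * ‖x‖ ≤ ‖A x‖ := by
  obtain ⟨W, hW⟩ := (LinearMap.ker (T : E →ₗ[ℂ] E)).exists_isCompl
  refine ⟨W, ?_, ?_⟩
  · have h1 := Submodule.finrank_add_eq_of_isCompl hW
    have h2 := LinearMap.finrank_range_add_finrank_ker (T : E →ₗ[ℂ] E)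
    omega
  · have hinj : LinearMap.ker ((T : E →ₗ[ℂ] E).domRestrict W) = ⊥ := by
      rw [LinearMap.ker_eq_bot, injective_iff_map_eq_zero]
      intro x hx
      have := (Submodule.disjoint_def.1 hW.disjoint) x hx x.2
      exact_mod_cast this
    obtain ⟨K, hK, hT⟩ := LinearMap.exists_antilipschitzWith _ hinj
    have hK' : (0 : ℝ) < K := hK
    refine ⟨(K : ℝ)⁻¹ / 2, by positivity, ?_⟩
    filter_upwards [Metric.ball_mem_nhds T (show (0 : ℝ) < (K : ℝ)⁻¹ / 2 by positivity)]
      with A hA x hx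
    have h1 : ‖x‖ ≤ K * ‖T x‖ := by
      simpa using hT.le_mul_dist ⟨x, hx⟩ 0
    have h1' : (K : ℝ)⁻¹ * ‖x‖ ≤ ‖T x‖ := by
      rwa [inv_mul_le_iff₀ hK']
    have h2 : ‖(A - T) x‖ ≤ (K : ℝ)⁻¹ / 2 * ‖x‖ := by
      refine (ContinuousLinearMap.le_opNorm _ _).trans ?_
      gcongr
      rw [← dist_eq_norm]
      exact (Metric.mem_ball.1 hA).le
    have h3 : ‖T x‖ ≤ ‖A x‖ + ‖(A - T) x‖ := by
      have : T x = A x - (A - T) x := by simp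
      rw [this]
      exact norm_sub_le _ _
    linarith

theorem tendsto_convex_comb {E : Type*} [NormedAddCommGroup E] [NormedSpace ℂ E]
    (T : E →L[ℂ] E) :
    Tendsto (fun ε : ℝ => ((1 - ε : ℝ) : ℂ) • T + (ε : ℂ) • ContinuousLinearMap.id ℂ E)
      (𝓝[>] 0) (𝓝 T) := by
  have hc : Continuous fun ε : ℝ =>
      ((1 - ε : ℝ) : ℂ) • T + (ε : ℂ) • ContinuousLinearMap.id ℂ E := by fun_prop
  have := hc.tendsto 0
  simp only [sub_zero, Complex.ofReal_one, one_smul, Complex.ofReal_zero, zero_smul,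
    add_zero] at this
  exact this.mono_left nhdsWithin_le_nhds

/-- If `T` has a `k`-dimensional kernel, then `|det|` of the perturbation `(1 - ε) T + ε id` is at
least of order `s ^ k` in its smallest singular value `s`, and so exceeds `s ^ p` for `p > k`. -/
theorem eventually_singularValues_rpow_lt_norm_det {E : Type*} [NormedAddCommGroup E]
    [InnerProductSpace ℂ E] [FiniteDimensional ℂ E] (T : E →L[ℂ] E) {k : ℕ}
    (hk : finrank ℂ (LinearMap.range (T : E →ₗ[ℂ] E)) + k = finrank ℂ E) (hk1 : 1 ≤ k)
    {p : ℝ} (hp : k < p) :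
    ∀ᶠ ε : ℝ in 𝓝[>] 0,
      ((((1 - ε : ℝ) : ℂ) • T + (ε : ℂ) • ContinuousLinearMap.id ℂ E : E →L[ℂ] E) :
          E →ₗ[ℂ] E).singularValues (finrank ℂ E - 1) ^ p <
        ‖(((1 - ε : ℝ) : ℂ) • T + (ε : ℂ) • ContinuousLinearMap.id ℂ E : E →L[ℂ] E).det‖ := by
  obtain ⟨W, hW, c, hc, hbd⟩ := exists_pos_eventually_bound_below T
  obtain ⟨x, hxT, hx0⟩ : ∃ x : E, T x = 0 ∧ x ≠ 0 := by
    have h2 := LinearMap.finrank_range_add_finrank_ker (T : E →ₗ[ℂ] E)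
    have : LinearMap.ker (T : E →ₗ[ℂ] E) ≠ ⊥ := by
      intro h
      rw [h, finrank_bot] at h2
      omega
    obtain ⟨x, hx, hx0⟩ := Submodule.exists_mem_ne_zero_of_ne_bot this
    exact ⟨x, hx, hx0⟩
  have hsmall : ∀ᶠ ε : ℝ in 𝓝[>] 0, ε ^ (p - k) < c ^ finrank ℂ W := by
    have hpk : 0 < p - k := sub_pos.2 hp
    have ht := (Real.continuous_rpow_const hpk.le).tendsto 0
    simp only [Real.zero_rpow hpk.ne'] at ht
    exact (ht.mono_left nhdsWithin_le_nhds).eventually (gt_mem_nhds (by positivity))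
  filter_upwards [hsmall, eventually_injective_convex_comb T,
    (tendsto_convex_comb T).eventually hbd, self_mem_nhdsWithin] with ε hε hinj hA hε0
  set A := ((1 - ε : ℝ) : ℂ) • T + (ε : ℂ) • ContinuousLinearMap.id ℂ E with hAdef
  have hn : finrank ℂ E - 1 < finrank ℂ E := by omega
  have hs := (LinearMap.injective_iff_forall_lt_finrank_singularValues_pos
    (A : E →ₗ[ℂ] E)).1 hinj _ hn
  have hsε : (A : E →ₗ[ℂ] E).singularValues (finrank ℂ E - 1) ≤ ε := by
    have h1 := singularValues_last_mul_norm_le (A : E →ₗ[ℂ] E) x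
    have h2 : (A : E →ₗ[ℂ] E) x = (ε : ℂ) • x := by simp [hAdef, hxT]
    rw [h2, norm_smul, Complex.norm_real, Real.norm_of_nonneg (le_of_lt hε0)] at h1
    exact le_of_mul_le_mul_right h1 (norm_pos_iff.2 hx0)
  have hdet := pow_mul_pow_le_norm_det A W hc.le hA
  have hnk : finrank ℂ E - finrank ℂ W = k := by omega
  rw [hnk] at hdet
  set s := (A : E →ₗ[ℂ] E).singularValues (finrank ℂ E - 1)
  calc s ^ p = s ^ (p - k) * s ^ k := by
        rw [← Real.rpow_natCast s k, ← Real.rpow_add hs, sub_add_cancel]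
    _ ≤ ε ^ (p - k) * s ^ k := by
        gcongr
    _ < c ^ finrank ℂ W * s ^ k := by gcongr
    _ ≤ ‖A.det‖ := hdet

/-! ### Lindblad generators -/

theorem inner_mat_eq_trace {d : ℕ} (A B : Mat d) : inner ℂ A B = (Aᴴ * B).trace := rfl

theorem norm_sq_mat_eq_trace {d : ℕ} (A : Mat d) : ((‖A‖ ^ 2 : ℝ) : ℂ) = (Aᴴ * A).trace := by
  rw [← inner_mat_eq_trace, inner_self_eq_norm_sq_to_K]
  simp

theorem trace_eq_sum_apply_single {d : ℕ} (T : Mat d →ₗ[ℂ] Mat d) :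
    LinearMap.trace ℂ (Mat d) T = ∑ i, ∑ j, T (Matrix.single i j 1) i j := by
  rw [LinearMap.trace_eq_matrix_trace ℂ (Matrix.stdBasis ℂ (Fin d) (Fin d)), Matrix.trace,
    Fintype.sum_prod_type]
  refine Finset.sum_congr rfl fun i _ => Finset.sum_congr rfl fun j _ => ?_
  rw [Matrix.diag_apply, LinearMap.toMatrix_apply, Matrix.stdBasis_eq_single]
  rfl

/-- By `trace_eq_sum_apply_single`, the left side is the trace of the superoperator
`ρ ↦ A ρ B`. -/
theorem sum_mul_single_mul_apply {d : ℕ} (A B : Mat d) :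
    ∑ i, ∑ j, (A * Matrix.single i j 1 * B : Mat d) i j = A.trace * B.trace := by
  rw [Matrix.trace, Matrix.trace, Finset.sum_mul_sum]
  refine Finset.sum_congr rfl fun i _ => Finset.sum_congr rfl fun j _ => ?_
  simp [Matrix.mul_apply, Matrix.single_apply, Finset.sum_ite_eq, ite_and]

theorem trace_lindblad {d m : ℕ} {L : SuperOp d} {H : Mat d} {V : Fin m → Mat d}
    (h : ∀ ρ : Mat d, L ρ = Complex.I • (ρ * H - H * ρ) +
      ∑ j, (V j * ρ * (V j)ᴴ - (1 / 2 : ℂ) • ((V j)ᴴ * V j * ρ + ρ * ((V j)ᴴ * V j)))) :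
    LinearMap.trace ℂ (Mat d) L =
      ((∑ j, (‖(V j).trace‖ ^ 2 - d * ‖V j‖ ^ 2) : ℝ) : ℂ) := by
  have hl : ∀ A : Mat d, ∑ i, ∑ j, (A * Matrix.single i j 1 : Mat d) i j = A.trace * d := by
    intro A
    simpa using sum_mul_single_mul_apply A 1
  have hr : ∀ A : Mat d, ∑ i, ∑ j, (Matrix.single i j 1 * A : Mat d) i j = d * A.trace := by
    intro A
    simpa using sum_mul_single_mul_apply 1 A
  have hterm : ∀ W : Mat d, ∑ i, ∑ j, (W * Matrix.single i j 1 * Wᴴ - (1 / 2 : ℂ) •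
      (Wᴴ * W * Matrix.single i j 1 + Matrix.single i j 1 * (Wᴴ * W)) : Mat d) i j =
      ((‖W.trace‖ ^ 2 - d * ‖W‖ ^ 2 : ℝ) : ℂ) := by
    intro W
    simp only [Matrix.sub_apply, Matrix.smul_apply, Matrix.add_apply, Finset.sum_sub_distrib,
      ← Finset.smul_sum, Finset.sum_add_distrib, sum_mul_single_mul_apply, hl, hr,
      ← norm_sq_mat_eq_trace, Matrix.trace_conjTranspose]
    rw [← starRingEnd_apply, Complex.mul_conj, Complex.normSq_eq_norm_sq, smul_eq_mul]
    push_cast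
    ring
  rw [trace_eq_sum_apply_single]
  simp only [ContinuousLinearMap.coe_coe, h, Matrix.add_apply, Matrix.sum_apply,
    Finset.sum_add_distrib]
  simp_rw [Finset.sum_comm (s := Finset.univ (α := Fin d)) (t := Finset.univ (α := Fin m)), hterm]
  simp only [Matrix.sub_apply, Matrix.smul_apply, ← Finset.smul_sum, Finset.sum_sub_distrib, hl, hr]
  push_cast
  simp [mul_comm]

theorem re_trace_commutator_skew {d : ℕ} {K : Mat d} (hK : Kᴴ = -K) (X : Mat d) :
    (Xᴴ * (K * X - X * K)).trace.re = 0 := by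
  have h1 : star (Xᴴ * (K * X)).trace = -(Xᴴ * (K * X)).trace := by
    rw [← Matrix.trace_conjTranspose]
    simp [Matrix.conjTranspose_mul, hK, Matrix.mul_assoc]
  have h2 : star (Xᴴ * (X * K)).trace = -(Xᴴ * (X * K)).trace := by
    rw [← Matrix.trace_conjTranspose]
    simp only [Matrix.conjTranspose_mul, hK, Matrix.conjTranspose_conjTranspose, Matrix.neg_mul,
      Matrix.trace_neg, neg_inj]
    rw [Matrix.mul_assoc, Matrix.trace_mul_comm, Matrix.mul_assoc]
  have e1 := congrArg Complex.re h1
  have e2 := congrArg Complex.re h2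
  simp only [Complex.star_def, Complex.conj_re, Complex.neg_re] at e1 e2
  rw [Matrix.mul_sub, Matrix.trace_sub, Complex.sub_re]
  linarith

/-- A dissipator is bounded below by `-2 ‖W‖²`; this only uses submultiplicativity of the
Frobenius norm. -/
theorem neg_two_mul_le_re_trace_dissipator {d : ℕ} (W X : Mat d) :
    -2 * ‖W‖ ^ 2 * ‖X‖ ^ 2 ≤ (Xᴴ * (W * X * Wᴴ - (1 / 2 : ℂ) •
      (Wᴴ * W * X + X * (Wᴴ * W)))).trace.re := by
  have h1 : (Xᴴ * (Wᴴ * W * X)).trace = ((‖W * X‖ ^ 2 : ℝ) : ℂ) := by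
    rw [norm_sq_mat_eq_trace, Matrix.conjTranspose_mul]
    simp only [Matrix.mul_assoc]
  have h2 : (Xᴴ * (X * (Wᴴ * W))).trace = ((‖X * Wᴴ‖ ^ 2 : ℝ) : ℂ) := by
    rw [norm_sq_mat_eq_trace, Matrix.conjTranspose_mul, Matrix.conjTranspose_conjTranspose,
      Matrix.mul_assoc W, Matrix.trace_mul_comm W]
    simp only [Matrix.mul_assoc]
  have h3 : -(‖X‖ * (‖W‖ * ‖X‖ * ‖W‖)) ≤ (Xᴴ * (W * X * Wᴴ)).trace.re := by
    refine neg_le_of_abs_le ((Complex.abs_re_le_norm _).trans ?_)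
    rw [← inner_mat_eq_trace]
    refine (norm_inner_le_norm _ _).trans ?_
    gcongr
    refine (Matrix.frobenius_norm_mul _ _).trans ?_
    rw [Matrix.frobenius_norm_conjTranspose]
    gcongr
    exact Matrix.frobenius_norm_mul _ _
  have h4 : ‖W * X‖ ^ 2 ≤ (‖W‖ * ‖X‖) ^ 2 := by
    gcongr
    exact Matrix.frobenius_norm_mul _ _
  have h5 : ‖X * Wᴴ‖ ^ 2 ≤ (‖X‖ * ‖W‖) ^ 2 := by
    gcongr
    refine (Matrix.frobenius_norm_mul _ _).trans_eq ?_
    rw [Matrix.frobenius_norm_conjTranspose]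
  have h6 : (Xᴴ * (W * X * Wᴴ - (1 / 2 : ℂ) • (Wᴴ * W * X + X * (Wᴴ * W)))).trace.re =
      (Xᴴ * (W * X * Wᴴ)).trace.re - 1 / 2 * (‖W * X‖ ^ 2 + ‖X * Wᴴ‖ ^ 2) := by
    rw [Matrix.mul_sub, Matrix.mul_smul, Matrix.mul_add, Matrix.trace_sub, Matrix.trace_smul,
      Matrix.trace_add, h1, h2, ← Complex.ofReal_add, Complex.sub_re, smul_eq_mul,
      Complex.re_mul_ofReal]
    norm_num
  rw [h6]
  linarith

/-- Shifting a Lindblad operator by a scalar changes its dissipator by a commutator with a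
skew-Hermitian matrix. -/
theorem dissipator_add_smul_one {d : ℕ} (W X : Mat d) (c : ℂ) :
    (W + c • 1) * X * (W + c • 1)ᴴ - (1 / 2 : ℂ) •
      ((W + c • 1)ᴴ * (W + c • 1) * X + X * ((W + c • 1)ᴴ * (W + c • 1))) =
    (W * X * Wᴴ - (1 / 2 : ℂ) • (Wᴴ * W * X + X * (Wᴴ * W))) +
      (((1 / 2 : ℂ) • (star c • W - c • Wᴴ)) * X - X * ((1 / 2 : ℂ) • (star c • W - c • Wᴴ))) := by
  simp only [Matrix.conjTranspose_add, Matrix.conjTranspose_smul, Matrix.conjTranspose_one,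
    Matrix.add_mul, Matrix.mul_add, Matrix.smul_mul, Matrix.mul_smul, Matrix.one_mul,
    Matrix.mul_one, Matrix.sub_mul, Matrix.mul_sub]
  module

theorem norm_sq_sub_trace {d : ℕ} (hd : d ≠ 0) (V : Mat d) :
    ‖V - (V.trace / d) • (1 : Mat d)‖ ^ 2 = ‖V‖ ^ 2 - ‖V.trace‖ ^ 2 / d := by
  have hd' : (d : ℂ) ≠ 0 := by exact_mod_cast hd
  apply Complex.ofReal_injective
  rw [norm_sq_mat_eq_trace, Complex.ofReal_sub, norm_sq_mat_eq_trace, Complex.ofReal_div,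
    ← Complex.normSq_eq_norm_sq, Complex.normSq_eq_conj_mul_self]
  simp only [Matrix.conjTranspose_sub, Matrix.conjTranspose_smul, Matrix.conjTranspose_one,
    Matrix.sub_mul, Matrix.mul_sub, Matrix.smul_mul, Matrix.mul_smul, Matrix.one_mul,
    Matrix.mul_one, Matrix.trace_sub, Matrix.trace_smul, Matrix.trace_conjTranspose,
    Matrix.trace_one, Fintype.card_fin, smul_eq_mul, Complex.star_def, map_div₀, map_natCast,
    Complex.ofReal_natCast]
  field_simp
  ring

/-- The inequality `Re ⟪X, L X⟫ ≥ (2 / d) Tr L ‖X‖²` behind this is checked one Lindblad operator at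
a time. -/
theorem IsLindbladGenerator.satisfiesPowerBound_exp {d : ℕ} (hd : d ≠ 0) {L : SuperOp d}
    (hL : IsLindbladGenerator L) : SatisfiesPowerBound (2 / (d : ℝ)) (exp L) := by
  obtain ⟨H, hH, m, V, h⟩ := hL
  have hd' : (d : ℝ) ≠ 0 := by exact_mod_cast hd
  refine _root_.satisfiesPowerBound_exp L (trace_lindblad h) fun X => ?_
  rw [h X, inner_mat_eq_trace, Matrix.mul_add, Matrix.trace_add, Complex.add_re,
    Matrix.mul_sum, Matrix.trace_sum, Complex.re_sum]
  have hham : (Xᴴ * (Complex.I • (X * H - H * X))).trace.re = 0 := by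
    have hK : (-Complex.I • H)ᴴ = -(-Complex.I • H) := by
      simp [Matrix.conjTranspose_smul, hH.eq]
    rw [← re_trace_commutator_skew hK X, Matrix.smul_mul, Matrix.mul_smul X, ← smul_sub, neg_smul,
      ← smul_neg, neg_sub]
  rw [hham, zero_add, Finset.mul_sum, Finset.sum_mul]
  refine Finset.sum_le_sum fun j _ => ?_
  -- `W` is the traceless part of `V j`, for which `‖W‖² = ‖V j‖² - |Tr (V j)|² / d`.
  set c := (V j).trace / d with hc
  set W := V j - c • (1 : Mat d) with hW
  have hV : V j = W + c • 1 := by rw [hW, sub_add_cancel]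
  have hsk : ((1 / 2 : ℂ) • (star c • W - c • Wᴴ))ᴴ = -((1 / 2 : ℂ) • (star c • W - c • Wᴴ)) := by
    simp only [Matrix.conjTranspose_smul, Matrix.conjTranspose_sub,
      Matrix.conjTranspose_conjTranspose, star_star]
    rw [← smul_neg, neg_sub]
    congr 1
    simp
  have hnorm := norm_sq_sub_trace hd (V j)
  rw [← hc, ← hW] at hnorm
  have hcoef : 2 / (d : ℝ) * (‖(V j).trace‖ ^ 2 - d * ‖V j‖ ^ 2) = -2 * ‖W‖ ^ 2 := by
    rw [hnorm]
    field_simp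
    ring
  rw [hcoef, hV, dissipator_add_smul_one, Matrix.mul_add Xᴴ, Matrix.trace_add,
    Complex.add_re, re_trace_commutator_skew hsk, add_zero]
  exact neg_two_mul_le_re_trace_dissipator W X

theorem IsInfinitesimalDivisible.satisfiesPowerBound {d : ℕ} (hd : d ≠ 0) {T : SuperOp d}
    (hT : IsInfinitesimalDivisible T) : SatisfiesPowerBound (2 / (d : ℝ)) T := by
  refine closure_minimal (fun S hS => ?_)
    (isClosed_satisfiesPowerBound (by positivity : (0 : ℝ) ≤ 2 / d)) hT
  obtain ⟨n, G, hG, -, rfl⟩ := hS 1 one_pos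
  refine SatisfiesPowerBound.list_prod fun A hA => ?_
  obtain ⟨j, rfl⟩ := (List.mem_ofFn' _ _).1 hA
  exact (hG j).satisfiesPowerBound_exp hd

/-! ### Singular values of superoperators -/

theorem finrank_mat (d : ℕ) : finrank ℂ (Mat d) = d ^ 2 := by
  rw [finrank_matrix]
  simp [sq]

theorem finrank_range_add_singularMultiplicity_zero {d : ℕ} (T : SuperOp d) :
    finrank ℂ (LinearMap.range (T : Mat d →ₗ[ℂ] Mat d)) + singularMultiplicity T 0 =
      finrank ℂ (Mat d) := by
  have hle := (LinearMap.range (T : Mat d →ₗ[ℂ] Mat d)).finrank_le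
  rw [finrank_mat] at hle ⊢
  set r := finrank ℂ (LinearMap.range (T : Mat d →ₗ[ℂ] Mat d)) with hr
  have h : singularMultiplicity T 0 = d ^ 2 - r := by
    simp only [singularMultiplicity, superSingularValue,
      LinearMap.singularValues_eq_zero_iff_le_finrank_range, ← hr]
    rw [Nat.card_eq_fintype_card, Fintype.card_subtype]
    have h1 : ({i : Fin (d ^ 2) | r ≤ (i : ℕ)} : Finset (Fin (d ^ 2))).map Fin.valEmbedding =
        Finset.Ico r (d ^ 2) := by
      ext a
      simp only [Finset.mem_map, Finset.mem_filter_univ, Fin.valEmbedding_apply, Finset.mem_Ico]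
      exact ⟨fun ⟨i, hi, hia⟩ => hia ▸ ⟨hi, i.isLt⟩, fun ⟨h1, h2⟩ => ⟨⟨a, h2⟩, h1, rfl⟩⟩
    rw [← Finset.card_map Fin.valEmbedding, h1, Nat.card_Ico]
  omega

/-- The smallest singular value is the optimal lower bound, so the bound on `‖T x‖` in the power
criterion is a bound on `minSingularValue T`. -/
theorem SatisfiesPowerBound.det_le_minSingularValue_rpow {d : ℕ} (hd : d ≠ 0) {T : SuperOp d}
    (hT : SatisfiesPowerBound (2 / (d : ℝ)) T) :
    T.det.re ≤ minSingularValue T ^ ((d : ℝ) / 2) := by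
  obtain ⟨-, h0, h⟩ := hT
  have hd' : (0 : ℝ) < d := by exact_mod_cast Nat.pos_of_ne_zero hd
  have hlt : d ^ 2 - 1 < finrank ℂ (⊤ : Submodule ℂ (Mat d)) := by
    rw [finrank_top, finrank_mat]
    have : 0 < d ^ 2 := by positivity
    omega
  have hs : T.det.re ^ (2 / (d : ℝ)) ≤ minSingularValue T :=
    le_singularValues_of_forall_mem (T : Mat d →ₗ[ℂ] Mat d) ⊤ (fun x _ => h x) hlt
  calc T.det.re = (T.det.re ^ (2 / (d : ℝ))) ^ ((d : ℝ) / 2) := by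
        rw [← Real.rpow_mul h0, div_mul_div_comm, mul_comm, div_self (by positivity),
          Real.rpow_one]
    _ ≤ minSingularValue T ^ ((d : ℝ) / 2) := by gcongr

/-! ### Completely positive maps -/

theorem ampliation_mixWithId {d : ℕ} (T : SuperOp d) (ε : ℝ) (n : ℕ)
    (X : Matrix (Fin d × Fin n) (Fin d × Fin n) ℂ) :
    ampliation (mixWithId T ε) n X = ((1 - ε : ℝ) : ℂ) • ampliation T n X + (ε : ℂ) • X := by
  ext p q
  simp [ampliation, mixWithId]

theorem IsQuantumChannel.mixWithId {d : ℕ} {T : SuperOp d} (hT : IsQuantumChannel T) {ε : ℝ}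
    (h0 : 0 ≤ ε) (h1 : ε ≤ 1) : IsQuantumChannel (mixWithId T ε) := by
  refine ⟨fun n X hX => ?_, fun ρ => ?_⟩
  · rw [ampliation_mixWithId]
    exact ((hT.1 n X hX).smul (by exact_mod_cast sub_nonneg.2 h1)).add
      (hX.smul (by exact_mod_cast h0))
  · simp only [_root_.mixWithId, add_apply, smul_apply,
      ContinuousLinearMap.id_apply, Matrix.trace_add, Matrix.trace_smul, hT.2, smul_eq_mul]
    push_cast
    ring

/-- The Choi matrix of a completely positive map is Hermitian, so the map preserves
Hermiticity. -/
theorem IsCompletelyPositive.star_apply_single {d : ℕ} {T : SuperOp d}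
    (hT : IsCompletelyPositive T) (i j a b : Fin d) :
    star (T (Matrix.single i j 1) a b) = T (Matrix.single j i 1) b a := by
  -- `v` is the unnormalized maximally entangled vector; its image is the Choi matrix.
  let v : Fin d × Fin d → ℂ := fun p => if p.1 = p.2 then 1 else 0
  have hX := (hT d _ (Matrix.posSemidef_vecMulVec_self_star v)).isHermitian
  have hsingle : ∀ i j : Fin d, (Matrix.of fun a b =>
      Matrix.vecMulVec v (star v) (a, i) (b, j)) = Matrix.single i j (1 : ℂ) := by
    intro i j
    ext a b
    simp only [Matrix.of_apply, Matrix.vecMulVec_apply, Matrix.single_apply, v, Pi.star_apply,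
      apply_ite star, star_one, star_zero]
    grind
  have h := hX.apply (b, j) (a, i)
  simpa only [ampliation, Matrix.of_apply, hsingle] using h

/-- Hermiticity preservation says that conjugating the matrix of `T` entrywise amounts to swapping
`(i, j)` with `(j, i)` in rows and columns, which does not change the determinant. -/
theorem IsCompletelyPositive.det_im {d : ℕ} {T : SuperOp d} (hT : IsCompletelyPositive T) :
    T.det.im = 0 := by
  set B := Matrix.stdBasis ℂ (Fin d) (Fin d)
  set M := LinearMap.toMatrix B B (T : Mat d →ₗ[ℂ] Mat d) with hM
  have happ : ∀ p q : Fin d × Fin d, M p q = T (Matrix.single q.1 q.2 1) p.1 p.2 := by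
    intro p q
    rw [hM, LinearMap.toMatrix_apply, show q = (q.1, q.2) from rfl, Matrix.stdBasis_eq_single]
    rfl
  have hconj : M.map (starRingEnd ℂ) =
      M.submatrix (Equiv.prodComm (Fin d) (Fin d)) (Equiv.prodComm (Fin d) (Fin d)) := by
    ext p q
    rw [Matrix.map_apply, Matrix.submatrix_apply, happ, happ]
    exact hT.star_apply_single _ _ _ _
  have hdet : T.det = M.det := (LinearMap.det_toMatrix B _).symm
  have h := RingHom.map_det (starRingEnd ℂ) M
  rw [RingHom.mapMatrix_apply, hconj, Matrix.det_submatrix_equiv_self] at h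
  rw [hdet]
  exact Complex.conj_eq_iff_im.1 h

/-! ### Perturbations of a channel towards the identity -/

theorem corollary4p9 {d k : ℕ} (T : SuperOp d) (hT : IsQuantumChannel T)
    (hk : singularMultiplicity T 0 = k) (hk1 : 1 ≤ k) (hkd : (k : ℝ) < (d : ℝ) / 2) :
    (∀ U ∈ 𝓝 T, ∃ S ∈ U, IsQuantumChannel S ∧ ¬ IsInfinitesimalDivisible S) ∧
    ∃ ε₀ : ℝ, 0 < ε₀ ∧ ∀ ε : ℝ, 0 < ε → ε < ε₀ →
      IsQuantumChannel (mixWithId T ε) ∧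
      ((mixWithId T ε).det.im = 0 ∧
        ((mixWithId T ε).det.re < 0 ∨
          minSingularValue (mixWithId T ε) ^ ((d : ℝ) / 2) < (mixWithId T ε).det.re)) ∧
      ¬ IsInfinitesimalDivisible (mixWithId T ε) := by
  have hd : d ≠ 0 := by
    rintro rfl
    have : (1 : ℝ) ≤ k := by exact_mod_cast hk1
    norm_num at hkd
    linarith
  have hrank := finrank_range_add_singularMultiplicity_zero T
  rw [hk] at hrank
  have hev : ∀ᶠ ε : ℝ in 𝓝[>] 0, IsQuantumChannel (mixWithId T ε) ∧
      ((mixWithId T ε).det.im = 0 ∧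
        ((mixWithId T ε).det.re < 0 ∨
          minSingularValue (mixWithId T ε) ^ ((d : ℝ) / 2) < (mixWithId T ε).det.re)) ∧
      ¬ IsInfinitesimalDivisible (mixWithId T ε) := by
    filter_upwards [eventually_singularValues_rpow_lt_norm_det T hrank hk1 hkd,
      Ioo_mem_nhdsGT (zero_lt_one' ℝ)] with ε hε h01
    have hch := hT.mixWithId h01.1.le h01.2.le
    have him := hch.1.det_im
    have hlt : minSingularValue (mixWithId T ε) ^ ((d : ℝ) / 2) < |(mixWithId T ε).det.re| := by
      have hnorm : ‖(mixWithId T ε).det‖ = |(mixWithId T ε).det.re| :=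
        (Complex.abs_re_eq_norm.2 him).symm
      rw [← hnorm, minSingularValue, ← finrank_mat]
      exact hε
    have hviol : (mixWithId T ε).det.re < 0 ∨
        minSingularValue (mixWithId T ε) ^ ((d : ℝ) / 2) < (mixWithId T ε).det.re := by
      rcases lt_or_ge (mixWithId T ε).det.re 0 with h | h
      · exact Or.inl h
      · rw [abs_of_nonneg h] at hlt
        exact Or.inr hlt
    refine ⟨hch, ⟨him, hviol⟩, fun hdiv => ?_⟩
    have hpow := hdiv.satisfiesPowerBound hd
    rcases hviol with h | h
    · exact h.not_ge hpow.2.1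
    · exact h.not_ge (hpow.det_le_minSingularValue_rpow hd)
  refine ⟨fun U hU => ?_, ?_⟩
  · obtain ⟨ε, hε, hεU⟩ := (hev.and ((tendsto_convex_comb T).eventually hU)).exists
    exact ⟨mixWithId T ε, hεU, hε.1, hε.2.2⟩
  · obtain ⟨ε₀, hε₀, h⟩ := mem_nhdsGT_iff_exists_Ioo_subset.1 hev
    exact ⟨ε₀, hε₀, fun ε h1 h2 => h ⟨h1, h2⟩⟩
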